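/- Let $\alpha,\beta>-1$ be real, and let $\mu$ be the Jacobi measure $d\mu(x)=(1-x)^{\alpha}(1+x)^{\beta}\,dx$ on $(-1,1)$. Let $P_n^{(\alpha,\beta)}$ ($n\ge 0$) be the monic orthogonal polynomials with respect to $\mu$, with $\|P_n^{(\alpha,\beta)}\|_\mu^2=\int_{-1}^1 \big(P_n^{(\alpha,\beta)}(x)\big)^2\,d\mu(x)$, let $$K_n(x,y)=\sum_{j=0}^{n}\frac{P_j^{(\alpha,\beta)}(x)\,P_j^{(\alpha,\beta)}(y)}{\|P_j^{(\alpha,\beta)}\|_\mu^2}$$ be their Christoffel–Darboux kernel, and write $K_n^{(k,s)}(x,y)=\dfrac{\partial^{k+s}K_n(x,y)}{\partial x^k\,\partial y^s}$. Then for all integers $k,s\ge 0$, $$\lim_{n\to+\infty}\frac{K_{n-1}^{(k,s)}(-1,-1)}{n^{2\beta+2k+2s+2}}=\frac{(-1)^{k+s}}{2^{\alpha+\beta+k+s+1}\,(\beta+k+s+1)\,\Gamma(\beta+k+1)\,\Gamma(\beta+s+1)}.$$ -/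

import Mathlib

open MeasureTheory Filter Topology Polynomial

noncomputable section

/-- The Jacobi measure `dμ(x) = (1 - x)^α (1 + x)^β dx` on the interval `(-1, 1)`. -/
def jacobiMeasure (α β : ℝ) : Measure ℝ :=
  (volume.restrict (Set.Ioo (-1 : ℝ) 1)).withDensity
    (fun x => ENNReal.ofReal ((1 - x) ^ α * (1 + x) ^ β))

/-- The pairing `⟨p, q⟩_μ = ∫ p q dμ` of two real polynomials. -/
def polyInner (μ : Measure ℝ) (p q : ℝ[X]) : ℝ :=
  ∫ x, p.eval x * q.eval x ∂μ

/-- The sequence of monic orthogonal polynomials of `μ`, constructed by the Gram–Schmidt process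
applied to `1, X, X², …` (without normalisation, so that each polynomial is monic). -/
def monicOP (μ : Measure ℝ) (n : ℕ) : ℝ[X] :=
  X ^ n - ∑ i : Fin n,
    C (polyInner μ (X ^ n) (monicOP μ i) / polyInner μ (monicOP μ i) (monicOP μ i)) *
      monicOP μ i
termination_by n
decreasing_by exact i.2

/-- The monic Jacobi polynomial `P_n^{(α,β)}`. -/
def jacobiP (α β : ℝ) (n : ℕ) : ℝ[X] :=
  monicOP (jacobiMeasure α β) n

/-- The Christoffel–Darboux kernel
`K_n(x, y) = ∑_{j=0}^{n} P_j(x) P_j(y) / ‖P_j‖²_μ` of the Jacobi polynomials. -/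
def jacobiCDKernel (α β : ℝ) (n : ℕ) (x y : ℝ) : ℝ :=
  ∑ j ∈ Finset.range (n + 1),
    (jacobiP α β j).eval x * (jacobiP α β j).eval y /
      polyInner (jacobiMeasure α β) (jacobiP α β j) (jacobiP α β j)

/-- The mixed partial derivative `K_n^{(k,s)}(x, y) = ∂^{k+s} K_n(x, y) / ∂x^k ∂y^s`. -/
def jacobiCDKernelDeriv (α β : ℝ) (n k s : ℕ) (x y : ℝ) : ℝ :=
  iteratedDeriv k (fun u => iteratedDeriv s (fun v => jacobiCDKernel α β n u v) y) x

end

/-! Expanded at the endpoint -1, the monic Jacobi polynomial has Gamma-quotient coefficients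
(`jacobiCoeff`), so its k-th derivative at -1 is k! times one coefficient. Pairing the explicit
polynomial with (1 + x)^m through the beta integral gives an n-th finite difference. For m < n it
acts on a polynomial of degree n - 1 and vanishes, so uniqueness of the monic orthogonal polynomial
(`eq_monicOP`) identifies the Gram–Schmidt output; for m = n it gives the norm
(`polyInner_jacobiP_self`). The n-th summand of the differentiated kernel is then a product of Gamma
quotients. By Γ(n + a + 1) ∼ n! n^a it grows like 2A n^(p - 1), with p = 2β + 2k + 2s + 2 and A
independent of n. Summing (`tendsto_sum_range_div_rpow`) gives 2A/p = A/(β + k + s + 1). -/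

/-! ### Moments, integrability and positivity for the Jacobi measure. -/

theorem integral_rpow_mul_one_sub_rpow {u v : ℝ} (hu : 0 < u) (hv : 0 < v) :
    ∫ t in (0 : ℝ)..1, t ^ (u - 1) * (1 - t) ^ (v - 1) = ProbabilityTheory.beta u v := by
  rw [ProbabilityTheory.beta_eq_betaIntegralReal u v hu hv, Complex.betaIntegral]
  have : ∫ x in (0 : ℝ)..1, (x : ℂ) ^ ((u : ℂ) - 1) * (1 - (x : ℂ)) ^ ((v : ℂ) - 1) =
      ∫ x in (0 : ℝ)..1, ((x ^ (u - 1) * (1 - x) ^ (v - 1) : ℝ) : ℂ) := by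
    refine intervalIntegral.integral_congr fun x hx => ?_
    rw [Set.uIcc_of_le zero_le_one] at hx
    rw [Complex.ofReal_mul, Complex.ofReal_cpow hx.1, Complex.ofReal_cpow (by linarith [hx.2])]
    push_cast
    rfl
  rw [this, intervalIntegral.integral_ofReal, Complex.ofReal_re]

theorem integral_one_sub_rpow_mul_one_add_rpow {α γ : ℝ} (hα : -1 < α) (hγ : -1 < γ) :
    ∫ x in (-1 : ℝ)..1, (1 - x) ^ α * (1 + x) ^ γ =
      2 ^ (α + γ + 1) * ProbabilityTheory.beta (γ + 1) (α + 1) := by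
  have h1 := intervalIntegral.integral_comp_mul_sub (a := 0) (b := 1)
    (fun x : ℝ => (1 - x) ^ α * (1 + x) ^ γ) (two_ne_zero) 1
  have h2 : ∫ x in (0 : ℝ)..1, (1 - (2 * x - 1)) ^ α * (1 + (2 * x - 1)) ^ γ =
      ∫ x in (0 : ℝ)..1, 2 ^ (α + γ) * (x ^ (γ + 1 - 1) * (1 - x) ^ (α + 1 - 1)) := by
    refine intervalIntegral.integral_congr fun x hx => ?_
    rw [Set.uIcc_of_le zero_le_one] at hx
    rw [show 1 - (2 * x - 1) = 2 * (1 - x) by ring, show 1 + (2 * x - 1) = 2 * x by ring,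
      Real.mul_rpow two_pos.le (by linarith [hx.2]), Real.mul_rpow two_pos.le hx.1,
      Real.rpow_add two_pos]
    simp only [add_sub_cancel_right]
    ring
  rw [h2, intervalIntegral.integral_const_mul,
    integral_rpow_mul_one_sub_rpow (by linarith) (by linarith)] at h1
  norm_num at h1
  rw [Real.rpow_add two_pos, Real.rpow_one]
  linarith

theorem integral_jacobiMeasure (α β : ℝ) (f : ℝ → ℝ) :
    ∫ x, f x ∂jacobiMeasure α β =
      ∫ x in Set.Ioo (-1 : ℝ) 1, ((1 - x) ^ α * (1 + x) ^ β) * f x := by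
  rw [jacobiMeasure, integral_withDensity_eq_integral_toReal_smul (by fun_prop) (by simp)]
  refine setIntegral_congr_fun measurableSet_Ioo fun x hx => ?_
  have := hx.1
  have := hx.2
  simp only [smul_eq_mul]
  rw [ENNReal.toReal_ofReal]
  exact mul_nonneg (Real.rpow_nonneg (by linarith) _) (Real.rpow_nonneg (by linarith) _)

theorem integral_one_add_pow_jacobiMeasure {α β : ℝ} (hα : -1 < α) (hβ : -1 < β) (m : ℕ) :
    ∫ x, (1 + x) ^ m ∂jacobiMeasure α β =
      2 ^ (α + β + m + 1) * (Real.Gamma (β + m + 1) * Real.Gamma (α + 1) /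
        Real.Gamma (α + β + m + 2)) := by
  have hm : (0 : ℝ) ≤ m := m.cast_nonneg
  have h := integral_one_sub_rpow_mul_one_add_rpow (α := α) (γ := β + m) hα (by linarith)
  rw [intervalIntegral.integral_of_le (by norm_num), ← integral_Ioc_eq_integral_Ioo.symm] at h
  rw [integral_jacobiMeasure, show α + β + m + 1 = α + (β + m) + 1 by ring,
    show α + β + m + 2 = β + m + 1 + (α + 1) by ring]
  refine Eq.trans ?_ h
  refine setIntegral_congr_fun measurableSet_Ioo fun x hx => ?_
  have := hx.1
  rw [Real.rpow_add (by linarith), Real.rpow_natCast]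
  ring

theorem integrable_one_add_pow_jacobiMeasure {α β : ℝ} (hα : -1 < α) (hβ : -1 < β) (m : ℕ) :
    Integrable (fun x => (1 + x) ^ m) (jacobiMeasure α β) := by
  -- A non-integrable function has integral 0 by convention, so a nonzero moment already proves
  -- integrability.
  refine not_imp_comm.1 integral_undef ?_
  have hm : (0 : ℝ) ≤ m := m.cast_nonneg
  rw [integral_one_add_pow_jacobiMeasure hα hβ]
  have := Real.Gamma_pos_of_pos (show 0 < β + m + 1 by linarith)
  have := Real.Gamma_pos_of_pos (show 0 < α + 1 by linarith)
  have := Real.Gamma_pos_of_pos (show 0 < α + β + m + 2 by linarith)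
  positivity

theorem eval_eq_sum_taylor_neg_one (p : ℝ[X]) (x : ℝ) :
    p.eval x = ∑ i ∈ Finset.range (p.natDegree + 1),
      (taylor (-1) p).coeff i * (1 + x) ^ i := by
  have h : p.eval x = (taylor (-1) p).eval (1 + x) := by
    rw [taylor_eval]
    congr 1
    ring
  rw [h, eval_eq_sum_range, natDegree_taylor]

theorem integrable_eval_jacobiMeasure {α β : ℝ} (hα : -1 < α) (hβ : -1 < β) (p : ℝ[X]) :
    Integrable (fun x => p.eval x) (jacobiMeasure α β) := by
  simp only [eval_eq_sum_taylor_neg_one p]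
  exact integrable_finsetSum _ fun i _ =>
    (integrable_one_add_pow_jacobiMeasure hα hβ i).const_mul _

theorem jacobiMeasure_eq_zero_of_finite {α β : ℝ} (S : Set ℝ) (hS : S.Finite) :
    jacobiMeasure α β S = 0 := by
  refine withDensity_absolutelyContinuous _ _ ?_
  exact Measure.absolutelyContinuous_of_le Measure.restrict_le_self (hS.measure_zero _)

theorem jacobiMeasure_ne_zero {α β : ℝ} (hα : -1 < α) (hβ : -1 < β) :
    jacobiMeasure α β ≠ 0 := by
  intro h
  have h0 := integral_one_add_pow_jacobiMeasure hα hβ 0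
  rw [h, integral_zero_measure] at h0
  have := Real.Gamma_pos_of_pos (show 0 < β + (0 : ℕ) + 1 by simp; linarith)
  have := Real.Gamma_pos_of_pos (show 0 < α + 1 by linarith)
  have := Real.Gamma_pos_of_pos (show 0 < α + β + (0 : ℕ) + 2 by simp; linarith)
  have : (0 : ℝ) < 2 ^ (α + β + (0 : ℕ) + 1) * (Real.Gamma (β + (0 : ℕ) + 1) * Real.Gamma (α + 1) /
        Real.Gamma (α + β + (0 : ℕ) + 2)) := by positivity
  linarith

/-- If the integral of p² vanished, almost every point would be a root of p; but the root set is
finite, hence null, and the measure is nonzero. -/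
theorem polyInner_self_jacobiMeasure_pos {α β : ℝ} (hα : -1 < α) (hβ : -1 < β) {p : ℝ[X]}
    (hp : p ≠ 0) : 0 < polyInner (jacobiMeasure α β) p p := by
  have hint : Integrable (fun x => p.eval x * p.eval x) (jacobiMeasure α β) := by
    simpa using integrable_eval_jacobiMeasure hα hβ (p * p)
  refine lt_of_le_of_ne (integral_nonneg fun x => mul_self_nonneg _) fun h => ?_
  have h0 := (integral_eq_zero_iff_of_nonneg (fun x => mul_self_nonneg _) hint).1 h.symm
  have h1 : ∀ᵐ x ∂jacobiMeasure α β, x ∉ {x | p.IsRoot x} :=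
    measure_eq_zero_iff_ae_notMem.1 (jacobiMeasure_eq_zero_of_finite _ (finite_setOfPred_isRoot hp))
  have h2 : ∀ᵐ x ∂jacobiMeasure α β, False := by
    filter_upwards [h0, h1] with x hx hx'
    exact hx' (mul_self_eq_zero.1 hx)
  rw [ae_iff] at h2
  simp only [not_false_eq_true, Set.ofPred_true] at h2
  exact jacobiMeasure_ne_zero hα hβ (Measure.measure_univ_eq_zero.1 h2)

/-! ### Gram–Schmidt polynomials and their uniqueness. -/

theorem polyInner_comm (μ : Measure ℝ) (p q : ℝ[X]) : polyInner μ p q = polyInner μ q p := by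
  simp only [polyInner, mul_comm]

theorem polyInner_C_mul (μ : Measure ℝ) (c : ℝ) (p q : ℝ[X]) :
    polyInner μ (C c * p) q = c * polyInner μ p q := by
  simp only [polyInner, eval_mul, eval_C, mul_assoc, integral_const_mul]

theorem polyInner_sub {μ : Measure ℝ} (hμ : ∀ p : ℝ[X], Integrable (fun x => p.eval x) μ)
    (p q r : ℝ[X]) : polyInner μ (p - q) r = polyInner μ p r - polyInner μ q r := by
  simp only [polyInner, eval_sub, sub_mul]
  exact integral_sub (by simpa using hμ (p * r)) (by simpa using hμ (q * r))

theorem polyInner_sum {μ : Measure ℝ} (hμ : ∀ p : ℝ[X], Integrable (fun x => p.eval x) μ)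
    {ι : Type*} (s : Finset ι) (f : ι → ℝ[X]) (r : ℝ[X]) :
    polyInner μ (∑ i ∈ s, f i) r = ∑ i ∈ s, polyInner μ (f i) r := by
  simp only [polyInner, eval_finsetSum, Finset.sum_mul]
  exact integral_finsetSum _ fun i _ => by simpa using hμ (f i * r)

theorem degree_monicOP_and_monic (μ : Measure ℝ) (n : ℕ) :
    (monicOP μ n).degree = n ∧ (monicOP μ n).Monic := by
  induction n using Nat.strong_induction_on with
  | _ n ih =>
    have hdeg : (∑ i : Fin n, C (polyInner μ (X ^ n) (monicOP μ i) /
        polyInner μ (monicOP μ i) (monicOP μ i)) * monicOP μ i).degree < (n : WithBot ℕ) := by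
      rw [← mem_degreeLT]
      refine Submodule.sum_mem _ fun i _ => ?_
      rw [← smul_eq_C_mul]
      refine Submodule.smul_mem _ _ ?_
      rw [mem_degreeLT, (ih i i.2).1]
      exact_mod_cast i.2
    have hlt := hdeg
    rw [← degree_X_pow (R := ℝ) n] at hlt
    rw [monicOP]
    exact ⟨by rw [degree_sub_eq_left_of_degree_lt hlt, degree_X_pow],
      (monic_X_pow n).sub_of_left hlt⟩

theorem degree_monicOP (μ : Measure ℝ) (n : ℕ) : (monicOP μ n).degree = n :=
  (degree_monicOP_and_monic μ n).1

theorem monic_monicOP (μ : Measure ℝ) (n : ℕ) : (monicOP μ n).Monic :=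
  (degree_monicOP_and_monic μ n).2

theorem polyInner_monicOP_of_lt {μ : Measure ℝ}
    (hμ : ∀ p : ℝ[X], Integrable (fun x => p.eval x) μ)
    (hpos : ∀ p : ℝ[X], p ≠ 0 → 0 < polyInner μ p p) {i n : ℕ} (hin : i < n) :
    polyInner μ (monicOP μ n) (monicOP μ i) = 0 := by
  induction n using Nat.strong_induction_on generalizing i with
  | _ n ih =>
    rw [monicOP, polyInner_sub hμ, polyInner_sum hμ, Finset.sum_eq_single ⟨i, hin⟩]
    · rw [polyInner_C_mul, div_mul_cancel₀ _ (hpos _ (monic_monicOP μ i).ne_zero).ne', sub_self]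
    · intro j _ hj
      rw [polyInner_C_mul]
      rcases lt_or_gt_of_ne (fun h : (j : ℕ) = i => hj (Fin.ext h)) with h | h
      · rw [polyInner_comm μ (monicOP μ j) (monicOP μ i), ih i hin h, mul_zero]
      · rw [ih j j.2 h, mul_zero]
    · simp

theorem polyInner_monicOP_of_degree_lt {μ : Measure ℝ}
    (hμ : ∀ p : ℝ[X], Integrable (fun x => p.eval x) μ)
    (hpos : ∀ p : ℝ[X], p ≠ 0 → 0 < polyInner μ p p) {n : ℕ} {q : ℝ[X]}
    (hq : q.degree < n) : polyInner μ q (monicOP μ n) = 0 := by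
  have key : ∀ d : ℕ, d ≤ n → ∀ q : ℝ[X], q.degree < d → polyInner μ q (monicOP μ n) = 0 := by
    intro d
    induction d with
    | zero =>
      intro _ q hq
      have : q = 0 := degree_eq_bot.1 (Nat.WithBot.lt_zero_iff.1 (by simpa using hq))
      simp [this, polyInner]
    | succ d ih =>
      intro hd q hq
      -- Since `monicOP μ d` is monic of degree d, subtracting this multiple removes the X^d term.
      have hlow : (q - C (q.coeff d) * monicOP μ d).degree < d := by
        rw [degree_lt_iff_coeff_zero]
        intro m hm
        have hmd : (monicOP μ d).natDegree = d := natDegree_eq_of_degree_eq_some (degree_monicOP μ d)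
        rw [coeff_sub, coeff_C_mul]
        rcases hm.eq_or_lt with rfl | hm
        · have := (monic_monicOP μ d).coeff_natDegree
          rw [hmd] at this
          rw [this, mul_one, sub_self]
        · rw [coeff_eq_zero_of_natDegree_lt (hmd.trans_lt hm),
            (degree_lt_iff_coeff_zero _ _).1 hq m hm, mul_zero, sub_zero]
      have h := ih (by omega) _ hlow
      rw [polyInner_sub hμ, polyInner_C_mul, polyInner_comm μ (monicOP μ d),
        polyInner_monicOP_of_lt hμ hpos (by omega : d < n), mul_zero, sub_zero] at h
      exact h
  exact key n le_rfl q hq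

/-- The difference of two monic candidates has degree below n, so it is orthogonal to both of them
and hence to itself. -/
theorem eq_monicOP {μ : Measure ℝ} (hμ : ∀ p : ℝ[X], Integrable (fun x => p.eval x) μ)
    (hpos : ∀ p : ℝ[X], p ≠ 0 → 0 < polyInner μ p p) {n : ℕ} {q : ℝ[X]}
    (hmonic : q.Monic) (hdeg : q.degree = n)
    (horth : ∀ r : ℝ[X], r.degree < n → polyInner μ q r = 0) : q = monicOP μ n := by
  by_contra hne
  have hlt : (q - monicOP μ n).degree < n := by
    rw [← hdeg]
    exact degree_sub_lt_left (hdeg.trans (degree_monicOP μ n).symm) hmonic.ne_zero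
      (hmonic.leadingCoeff.trans (monic_monicOP μ n).leadingCoeff.symm)
  have h := hpos _ (sub_ne_zero.2 hne)
  rw [polyInner_sub hμ, horth _ hlt, polyInner_comm, polyInner_monicOP_of_degree_lt hμ hpos hlt,
    sub_zero] at h
  exact h.false

/-! ### Finite-difference identities. -/

theorem sum_alternating_choose_mul_eval_eq_zero {n : ℕ} {R : ℝ[X]} (hR : R.natDegree < n) :
    ∑ i ∈ Finset.range (n + 1), (-1 : ℝ) ^ (n - i) * n.choose i * R.eval (i : ℝ) = 0 := by
  have h := congrFun (fwdDiff_iter_eq_zero_of_degree_lt hR) 0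
  rw [fwdDiff_iter_eq_sum_shift] at h
  simpa using h

theorem fwdDiff_iter_inv {c : ℝ} (hc : 0 < c) (n : ℕ) :
    (fwdDiff 1)^[n] (fun x : ℝ => x⁻¹) c =
      (-1) ^ n * n.factorial / (ascPochhammer ℝ (n + 1)).eval c := by
  induction n generalizing c with
  | zero => simp
  | succ n ih =>
    rw [Function.iterate_succ_apply', fwdDiff, ih hc, ih (by linarith : 0 < c + 1)]
    have h0 := ascPochhammer_pos n (c + 1) (by linarith)
    have h2 : (ascPochhammer ℝ (n + 1)).eval c = c * (ascPochhammer ℝ n).eval (c + 1) := by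
      rw [ascPochhammer_succ_left]; simp
    have h3 : (ascPochhammer ℝ (n + 1 + 1)).eval c =
        c * ((ascPochhammer ℝ n).eval (c + 1) * (c + 1 + n)) := by
      rw [ascPochhammer_succ_left]; simp [ascPochhammer_succ_eval]
    rw [h2, h3, ascPochhammer_succ_eval, Nat.factorial_succ]
    have hn : 0 < c + 1 + (n : ℝ) := by positivity
    push_cast
    field_simp
    ring

theorem sum_alternating_choose_mul_inv {c : ℝ} (hc : 0 < c) (n : ℕ) :
    ∑ i ∈ Finset.range (n + 1), (-1 : ℝ) ^ (n - i) * n.choose i * (i + c)⁻¹ =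
      (-1) ^ n * n.factorial / (ascPochhammer ℝ (n + 1)).eval c := by
  rw [← fwdDiff_iter_inv hc, fwdDiff_iter_eq_sum_shift]
  refine Finset.sum_congr rfl fun i _ => ?_
  simp [add_comm]

/-- Dividing R by X + c leaves a quotient of degree below n, which the n-th difference kills, and
the remainder R(-c) times 1/(i + c). -/
theorem sum_alternating_choose_mul_eval_div {n : ℕ} {R : ℝ[X]} (hR : R.natDegree ≤ n) {c : ℝ}
    (hc : 0 < c) :
    ∑ i ∈ Finset.range (n + 1), (-1 : ℝ) ^ (n - i) * n.choose i * (R.eval (i : ℝ) / (i + c)) =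
      R.eval (-c) * ((-1) ^ n * n.factorial / (ascPochhammer ℝ (n + 1)).eval c) := by
  obtain ⟨S, hS⟩ := X_sub_C_dvd_sub_C_eval (a := -c) (p := R)
  have heval : ∀ i : ℕ, R.eval (i : ℝ) / (i + c) = S.eval (i : ℝ) + R.eval (-c) * (i + c)⁻¹ := by
    intro i
    have h := congrArg (eval (i : ℝ)) hS
    simp only [eval_sub, eval_C, eval_mul, eval_X, sub_neg_eq_add] at h
    have : (0 : ℝ) < i + c := by positivity
    field_simp
    linarith
  have hSum : ∑ i ∈ Finset.range (n + 1), (-1 : ℝ) ^ (n - i) * n.choose i * S.eval (i : ℝ) = 0 := by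
    by_cases hS0 : S = 0
    · simp [hS0]
    refine sum_alternating_choose_mul_eval_eq_zero ?_
    have h := congrArg natDegree hS
    rw [natDegree_sub_C, natDegree_mul (X_sub_C_ne_zero _) hS0, natDegree_X_sub_C] at h
    omega
  simp only [heval, mul_add, Finset.sum_add_distrib, hSum, zero_add]
  rw [← sum_alternating_choose_mul_inv hc, Finset.mul_sum]
  exact Finset.sum_congr rfl fun i _ => by ring

/-- Supplies the value R(-c) when the norm is computed. -/
theorem ascPochhammer_eval_neg_add (n : ℕ) (a : ℝ) :
    (ascPochhammer ℝ n).eval (-(a + n)) = (-1) ^ n * (ascPochhammer ℝ n).eval (a + 1) := by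
  rw [ascPochhammer_eval_neg_eq_descPochhammer, descPochhammer_eval_eq_ascPochhammer]
  congr 2
  ring

/-! ### Gamma quotients and asymptotics of power-like sums. -/

theorem Gamma_add_natCast {x : ℝ} (hx : 0 < x) (n : ℕ) :
    Real.Gamma (x + n) = (ascPochhammer ℝ n).eval x * Real.Gamma x := by
  induction n with
  | zero => simp
  | succ n ih =>
    have : 0 < x + n := by positivity
    rw [Nat.cast_succ, ← add_assoc, Real.Gamma_add_one this.ne', ih, ascPochhammer_succ_eval]
    ring

/-- The quotient equals Γ(a) / `Real.GammaSeq a n`, so this is Euler's limit formula. -/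
theorem tendsto_Gamma_add_div_of_pos {a : ℝ} (ha : 0 < a) :
    Tendsto (fun n : ℕ => Real.Gamma (n + a + 1) / (n.factorial * (n : ℝ) ^ a)) atTop (𝓝 1) := by
  have hΓ := Real.Gamma_pos_of_pos ha
  have h := (Real.GammaSeq_tendsto_Gamma a).inv₀ hΓ.ne' |>.const_mul (Real.Gamma a)
  rw [mul_inv_cancel₀ hΓ.ne'] at h
  refine h.congr fun n => ?_
  have hG : ∀ m : ℕ, Real.Gamma (m + a) = Real.Gamma a * ∏ j ∈ Finset.range m, (a + j) := by
    intro m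
    induction m with
    | zero => simp
    | succ m ih =>
      rw [Finset.prod_range_succ, ← mul_assoc, ← ih, Nat.cast_succ,
        show (m : ℝ) + 1 + a = m + a + 1 by ring, Real.Gamma_add_one (by positivity)]
      ring
  have h1 := hG (n + 1)
  rw [show ((n + 1 : ℕ) : ℝ) + a = n + a + 1 by push_cast; ring] at h1
  rw [Real.GammaSeq, h1, inv_div]
  ring

theorem tendsto_natCast_add_div (c : ℝ) :
    Tendsto (fun n : ℕ => ((n : ℝ) + c) / n) atTop (𝓝 1) := by
  have h := (tendsto_const_div_atTop_nhds_zero_nat c).const_add 1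
  rw [add_zero] at h
  refine h.congr' ?_
  filter_upwards [eventually_gt_atTop 0] with n hn
  field_simp

/-- A descent step by Γ(x + 1) = xΓ(x), extending the asymptotics to a ≤ 0; the exponents -k, -s and
α + β require this. -/
theorem tendsto_Gamma_add_div_of_add_one {a : ℝ}
    (h : Tendsto (fun n : ℕ => Real.Gamma (n + (a + 1) + 1) / (n.factorial * (n : ℝ) ^ (a + 1)))
      atTop (𝓝 1)) :
    Tendsto (fun n : ℕ => Real.Gamma (n + a + 1) / (n.factorial * (n : ℝ) ^ a)) atTop (𝓝 1) := by
  have h2 := h.div (tendsto_natCast_add_div (a + 1)) one_ne_zero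
  rw [div_one] at h2
  refine h2.congr' ?_
  have hev : ∀ᶠ n : ℕ in atTop, -(a + 1) < (n : ℝ) :=
    tendsto_natCast_atTop_atTop.eventually_gt_atTop _
  filter_upwards [eventually_gt_atTop 0, hev] with n hn hna
  have hn' : (0 : ℝ) < n := by exact_mod_cast hn
  have hpos : 0 < (n : ℝ) + a + 1 := by linarith
  have hpow : (n : ℝ) ^ a ≠ 0 := (Real.rpow_pos_of_pos hn' a).ne'
  rw [Pi.div_apply, show (n : ℝ) + (a + 1) + 1 = n + a + 1 + 1 by ring, Real.Gamma_add_one hpos.ne',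
    Real.rpow_add hn', Real.rpow_one, ← add_assoc]
  field_simp

/-- `Γ(n + a + 1) ∼ n! n ^ a` as `n → ∞`. -/
theorem tendsto_Gamma_add_div (a : ℝ) :
    Tendsto (fun n : ℕ => Real.Gamma (n + a + 1) / (n.factorial * (n : ℝ) ^ a)) atTop (𝓝 1) := by
  obtain ⟨m, hm⟩ := exists_nat_gt (-a)
  have key : ∀ m : ℕ, ∀ a : ℝ, -a < m →
      Tendsto (fun n : ℕ => Real.Gamma (n + a + 1) / (n.factorial * (n : ℝ) ^ a))
        atTop (𝓝 1) := by
    intro m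
    induction m with
    | zero => exact fun a ha => tendsto_Gamma_add_div_of_pos (by simpa using ha)
    | succ m ih =>
      intro a ha
      push_cast at ha
      exact tendsto_Gamma_add_div_of_add_one (ih (a + 1) (by linarith))
  exact key m a hm

/-- After factoring out n^p, this is the difference quotient of x^p at 1 with step 1/n. -/
theorem tendsto_rpow_add_one_sub_div (p : ℝ) :
    Tendsto (fun n : ℕ => (((n : ℝ) + 1) ^ p - (n : ℝ) ^ p) / (n : ℝ) ^ (p - 1)) atTop (𝓝 p) := by
  have hd : HasDerivAt (fun x : ℝ => x ^ p) p 1 := by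
    simpa using Real.hasDerivAt_rpow_const (x := 1) (p := p) (Or.inl one_ne_zero)
  have h := hd.tendsto_slope_zero.comp
    (tendsto_nhdsWithin_iff.2 ⟨tendsto_inv_atTop_nhds_zero_nat (𝕜 := ℝ), by
      filter_upwards [eventually_gt_atTop 0] with n hn
      simpa using hn.ne'⟩)
  refine h.congr' ?_
  filter_upwards [eventually_gt_atTop 0] with n hn
  have hn' : (0 : ℝ) < n := by exact_mod_cast hn
  have hpow : (n : ℝ) ^ p ≠ 0 := (Real.rpow_pos_of_pos hn' p).ne'
  have h1 : (n : ℝ) + 1 = n * (1 + (n : ℝ)⁻¹) := by field_simp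
  rw [Function.comp_apply, inv_inv, smul_eq_mul, Real.one_rpow, h1,
    Real.mul_rpow hn'.le (by positivity), Real.rpow_sub_one hn'.ne']
  field_simp

/-- If `a n ∼ L n ^ (p - 1)` with `p > 0`, then `∑ j < n, a j ∼ (L / p) n ^ p`. -/
theorem tendsto_sum_range_div_rpow {a : ℕ → ℝ} {p L : ℝ} (hp : 0 < p)
    (ha : Tendsto (fun n : ℕ => a n / (n : ℝ) ^ (p - 1)) atTop (𝓝 L)) :
    Tendsto (fun n : ℕ => (∑ j ∈ Finset.range n, a j) / (n : ℝ) ^ p) atTop (𝓝 (L / p)) := by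
  -- The increments g telescope to n^p and satisfy g n ∼ p n^(p - 1). Thus a - (L/p) g = o(g), and
  -- little-o passes to partial sums because those of g diverge.
  set g : ℕ → ℝ := fun n => ((n : ℝ) + 1) ^ p - (n : ℝ) ^ p with hg
  have hgpos : ∀ n, 0 < g n := fun n =>
    sub_pos.2 (Real.rpow_lt_rpow n.cast_nonneg (by linarith) hp)
  have hgsum : ∀ n : ℕ, ∑ j ∈ Finset.range n, g j = (n : ℝ) ^ p := by
    intro n
    have := Finset.sum_range_sub (fun j : ℕ => (j : ℝ) ^ p) n
    simpa [hg, Real.zero_rpow hp.ne'] using this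
  have hratio : Tendsto (fun n => (a n - L / p * g n) / g n) atTop (𝓝 0) := by
    have h := (ha.div (tendsto_rpow_add_one_sub_div p) hp.ne').sub_const (L / p)
    rw [sub_self] at h
    refine h.congr' ?_
    filter_upwards [eventually_gt_atTop 0] with n hn
    have hn' : (0 : ℝ) < n := by exact_mod_cast hn
    have hpow := (Real.rpow_pos_of_pos hn' (p - 1)).ne'
    have := (hgpos n).ne'
    simp only [Pi.div_apply]
    change a n / (n : ℝ) ^ (p - 1) / (g n / (n : ℝ) ^ (p - 1)) - _ = _
    field_simp
  have ho : (fun n => a n - L / p * g n) =o[atTop] g :=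
    (Asymptotics.isLittleO_iff_tendsto fun n h => absurd h (hgpos n).ne').2 hratio
  have htop : Tendsto (fun n => ∑ j ∈ Finset.range n, g j) atTop atTop := by
    simp only [hgsum]
    exact (tendsto_rpow_atTop hp).comp tendsto_natCast_atTop_atTop
  have hs := (ho.sum_range (fun n => (hgpos n).le) htop).tendsto_div_nhds_zero
  simp only [Finset.sum_sub_distrib, ← Finset.mul_sum, hgsum] at hs
  have h := hs.add_const (L / p)
  rw [zero_add] at h
  refine h.congr' ?_
  filter_upwards [eventually_gt_atTop 0] with n hn
  have hn' : (0 : ℝ) < n := by exact_mod_cast hn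
  have hpow := (Real.rpow_pos_of_pos hn' p).ne'
  field_simp
  ring

/-! ### Explicit Jacobi polynomials, orthogonality and norm. -/

/-- The coefficient of `(1 + x) ^ i` in the monic Jacobi polynomial of degree `n ≥ 1`. -/
noncomputable def jacobiCoeff (α β : ℝ) (n i : ℕ) : ℝ :=
  (-1) ^ (n - i) * (n.choose i : ℝ) * 2 ^ ((n : ℝ) - i) *
    (Real.Gamma (β + n + 1) / Real.Gamma (β + i + 1) *
      (Real.Gamma (α + β + n + i + 1) / Real.Gamma (α + β + 2 * n + 1)))

/-- The explicit hypergeometric form of the monic Jacobi polynomial of degree `n ≥ 1`. -/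
noncomputable def jacobiExplicit (α β : ℝ) (n : ℕ) : ℝ[X] :=
  taylor 1 (∑ i ∈ Finset.range (n + 1), C (jacobiCoeff α β n i) * X ^ i)

section
variable {α β : ℝ}

theorem coeff_sum_jacobiCoeff (n i : ℕ) :
    (∑ i ∈ Finset.range (n + 1), C (jacobiCoeff α β n i) * X ^ i).coeff i =
      jacobiCoeff α β n i := by
  rw [finsetSum_coeff]
  simp only [coeff_C_mul, coeff_X_pow, mul_ite, mul_one, mul_zero, Finset.sum_ite_eq,
    Finset.mem_range]
  split_ifs with h
  · rfl
  · simp [jacobiCoeff, Nat.choose_eq_zero_of_lt (by omega : n < i)]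

theorem taylor_neg_one_jacobiExplicit_coeff (n i : ℕ) :
    (taylor (-1) (jacobiExplicit α β n)).coeff i = jacobiCoeff α β n i := by
  rw [jacobiExplicit, taylor_taylor, neg_add_cancel, taylor_zero, coeff_sum_jacobiCoeff]

theorem eval_jacobiExplicit (n : ℕ) (x : ℝ) :
    (jacobiExplicit α β n).eval x =
      ∑ i ∈ Finset.range (n + 1), jacobiCoeff α β n i * (1 + x) ^ i := by
  simp [jacobiExplicit, eval_finsetSum, add_comm]

/-- The case n = 0 is excluded because Γ(α + β + 1) / Γ(α + β + 1) evaluates to 0 rather than 1 when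
α + β = -1. -/
theorem jacobiCoeff_self (hα : -1 < α) (hβ : -1 < β) {n : ℕ} (hn : 1 ≤ n) :
    jacobiCoeff α β n n = 1 := by
  have hn' : (1 : ℝ) ≤ n := by exact_mod_cast hn
  have h1 := Real.Gamma_pos_of_pos (show 0 < β + n + 1 by linarith)
  have h2 := Real.Gamma_pos_of_pos (show 0 < α + β + 2 * n + 1 by linarith)
  rw [jacobiCoeff, show α + β + n + n + 1 = α + β + 2 * n + 1 by ring, div_self h1.ne',
    div_self h2.ne']
  simp

theorem degree_jacobiExplicit (hα : -1 < α) (hβ : -1 < β) {n : ℕ} (hn : 1 ≤ n) :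
    (jacobiExplicit α β n).degree = n := by
  rw [jacobiExplicit, degree_taylor]
  refine degree_eq_of_le_of_coeff_ne_zero ?_ ?_
  · rw [degree_le_iff_coeff_zero]
    intro m hm
    rw [coeff_sum_jacobiCoeff, jacobiCoeff, Nat.choose_eq_zero_of_lt (by exact_mod_cast hm)]
    simp
  · rw [coeff_sum_jacobiCoeff, jacobiCoeff_self hα hβ hn]
    exact one_ne_zero

theorem monic_jacobiExplicit (hα : -1 < α) (hβ : -1 < β) {n : ℕ} (hn : 1 ≤ n) :
    (jacobiExplicit α β n).Monic := by
  have h := degree_jacobiExplicit hα hβ hn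
  rw [jacobiExplicit, degree_taylor] at h
  rw [Monic, jacobiExplicit, leadingCoeff_taylor, leadingCoeff,
    natDegree_eq_of_degree_eq_some h, coeff_sum_jacobiCoeff, jacobiCoeff_self hα hβ hn]

theorem polyInner_jacobiExplicit_one_add_pow (hα : -1 < α) (hβ : -1 < β) (n m : ℕ) :
    polyInner (jacobiMeasure α β) (jacobiExplicit α β n) ((1 + X) ^ m) =
      2 ^ (α + β + n + m + 1) * (Real.Gamma (β + n + 1) * Real.Gamma (α + 1) /
        Real.Gamma (α + β + 2 * n + 1)) *
      ∑ i ∈ Finset.range (n + 1), (-1 : ℝ) ^ (n - i) * n.choose i *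
        (Real.Gamma (β + i + 1 + m) / Real.Gamma (β + i + 1) *
          (Real.Gamma (α + β + n + i + 1) / Real.Gamma (α + β + i + m + 2))) := by
  have h : ∀ x : ℝ, (jacobiExplicit α β n).eval x * ((1 + X) ^ m : ℝ[X]).eval x =
      ∑ i ∈ Finset.range (n + 1), jacobiCoeff α β n i * (1 + x) ^ (i + m) := by
    intro x
    rw [eval_jacobiExplicit, Finset.sum_mul]
    refine Finset.sum_congr rfl fun i _ => ?_
    simp only [eval_pow, eval_add, eval_one, eval_X]
    ring
  simp only [polyInner, h]
  rw [integral_finsetSum _ fun i _ =>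
    (integrable_one_add_pow_jacobiMeasure hα hβ (i + m)).const_mul _, Finset.mul_sum]
  refine Finset.sum_congr rfl fun i _ => ?_
  rw [integral_const_mul, integral_one_add_pow_jacobiMeasure hα hβ, jacobiCoeff]
  have h2 : (2 : ℝ) ^ (α + β + n + m + 1) =
      2 ^ ((n : ℝ) - i) * 2 ^ (α + β + ((i + m : ℕ) : ℝ) + 1) := by
    rw [← Real.rpow_add two_pos]
    congr 1
    push_cast
    ring
  rw [h2]
  push_cast
  rw [show β + (i + m : ℝ) + 1 = β + i + 1 + m by ring,
    show α + β + (i + m : ℝ) + 2 = α + β + i + m + 2 by ring]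
  ring

/-- With n = m + r + 1, the two Gamma quotients are Pochhammer polynomials in i of degrees m and r.
Their product has degree n - 1, so its n-th difference vanishes. -/
theorem polyInner_jacobiExplicit_one_add_pow_of_lt (hα : -1 < α) (hβ : -1 < β) {n m : ℕ}
    (hmn : m < n) :
    polyInner (jacobiMeasure α β) (jacobiExplicit α β n) ((1 + X) ^ m) = 0 := by
  obtain ⟨r, rfl⟩ := Nat.exists_eq_add_of_lt hmn
  rw [polyInner_jacobiExplicit_one_add_pow hα hβ]
  refine mul_eq_zero_of_right _ ?_
  have hR : ((ascPochhammer ℝ m).comp (X + C (β + 1)) *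
      (ascPochhammer ℝ r).comp (X + C (α + β + m + 2))).natDegree < m + r + 1 := by
    refine Nat.lt_succ_of_le (natDegree_mul_le.trans ?_)
    rw [natDegree_comp, natDegree_comp, natDegree_X_add_C, natDegree_X_add_C,
      ascPochhammer_natDegree, ascPochhammer_natDegree]
    omega
  rw [← sum_alternating_choose_mul_eval_eq_zero hR]
  refine Finset.sum_congr rfl fun i _ => ?_
  congr 1
  have hi : (0 : ℝ) ≤ i := i.cast_nonneg
  have hm : (0 : ℝ) ≤ m := m.cast_nonneg
  have hp1 : 0 < β + i + 1 := by linarith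
  have hp2 : 0 < α + β + i + m + 2 := by linarith
  have e : α + β + ((m + r + 1 : ℕ) : ℝ) + i + 1 = α + β + i + m + 2 + r := by push_cast; ring
  rw [e, Gamma_add_natCast hp1, Gamma_add_natCast hp2,
    mul_div_cancel_right₀ _ (Real.Gamma_pos_of_pos hp1).ne',
    mul_div_cancel_right₀ _ (Real.Gamma_pos_of_pos hp2).ne']
  simp only [eval_mul, eval_comp, eval_add, eval_X, eval_C]
  congr 2 <;> ring

theorem polyInner_jacobiExplicit_of_degree_lt (hα : -1 < α) (hβ : -1 < β) {n : ℕ} {r : ℝ[X]}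
    (hr : r.degree < n) : polyInner (jacobiMeasure α β) (jacobiExplicit α β n) r = 0 := by
  have hr' : r = ∑ i ∈ Finset.range (r.natDegree + 1),
      C ((taylor (-1) r).coeff i) * (1 + X) ^ i := by
    refine Polynomial.funext fun x => ?_
    rw [eval_eq_sum_taylor_neg_one]
    simp [eval_finsetSum]
  by_cases h0 : r = 0
  · simp [h0, polyInner]
  have hdeg : r.natDegree < n := (natDegree_lt_iff_degree_lt h0).2 hr
  rw [polyInner_comm, hr', polyInner_sum (integrable_eval_jacobiMeasure hα hβ)]
  refine Finset.sum_eq_zero fun i hi => ?_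
  rw [polyInner_C_mul, polyInner_comm, polyInner_jacobiExplicit_one_add_pow_of_lt hα hβ
    ((Nat.lt_succ_iff.1 (Finset.mem_range.1 hi)).trans_lt hdeg), mul_zero]

theorem jacobiP_eq_jacobiExplicit (hα : -1 < α) (hβ : -1 < β) {n : ℕ} (hn : 1 ≤ n) :
    jacobiP α β n = jacobiExplicit α β n :=
  (eq_monicOP (integrable_eval_jacobiMeasure hα hβ)
    (fun _ => polyInner_self_jacobiMeasure_pos hα hβ) (monic_jacobiExplicit hα hβ hn)
    (degree_jacobiExplicit hα hβ hn)
    fun _ => polyInner_jacobiExplicit_of_degree_lt hα hβ).symm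

/-- By orthogonality one factor can be replaced by (1 + X)^n. Then the second Gamma quotient
collapses to 1/(i + c) with c = α + β + n + 1, and `sum_alternating_choose_mul_eval_div` evaluates
the sum. -/
theorem polyInner_jacobiP_self (hα : -1 < α) (hβ : -1 < β) {n : ℕ} (hn : 1 ≤ n) :
    polyInner (jacobiMeasure α β) (jacobiP α β n) (jacobiP α β n) =
      2 ^ (α + β + 2 * n + 1) * (Real.Gamma (β + n + 1) * Real.Gamma (α + n + 1) * n.factorial *
        Real.Gamma (α + β + n + 1)) /
        (Real.Gamma (α + β + 2 * n + 1) * Real.Gamma (α + β + 2 * n + 2)) := by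
  have hn' : (1 : ℝ) ≤ n := by exact_mod_cast hn
  have hmonic : ((1 + X) ^ n : ℝ[X]).Monic := by
    rw [add_comm, ← C_1]
    exact (monic_X_add_C 1).pow n
  have hdegree : ((1 + X) ^ n : ℝ[X]).degree = n := by
    rw [add_comm, ← C_1, degree_pow, degree_X_add_C, nsmul_one]
  have hlt : (jacobiExplicit α β n - (1 + X) ^ n : ℝ[X]).degree < n := by
    have h := degree_jacobiExplicit hα hβ hn
    rw [← h]
    exact degree_sub_lt_left (h.trans hdegree.symm) (monic_jacobiExplicit hα hβ hn).ne_zero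
      ((monic_jacobiExplicit hα hβ hn).leadingCoeff.trans hmonic.leadingCoeff.symm)
  have h := polyInner_jacobiExplicit_of_degree_lt hα hβ hlt
  rw [polyInner_comm, polyInner_sub (integrable_eval_jacobiMeasure hα hβ), sub_eq_zero,
    polyInner_comm _ ((1 + X) ^ n), polyInner_jacobiExplicit_one_add_pow hα hβ] at h
  rw [jacobiP_eq_jacobiExplicit hα hβ hn, h]
  have hc : 0 < α + β + n + 1 := by linarith
  have hR : ((ascPochhammer ℝ n).comp (X + C (β + 1))).natDegree ≤ n := by
    rw [natDegree_comp, natDegree_X_add_C, ascPochhammer_natDegree, mul_one]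
  have hsum := sum_alternating_choose_mul_eval_div hR hc
  rw [eval_comp, eval_add, eval_X, eval_C,
    show -(α + β + n + 1) + (β + 1) = -(α + n) by ring, ascPochhammer_eval_neg_add] at hsum
  have hsum' : ∑ i ∈ Finset.range (n + 1), (-1 : ℝ) ^ (n - i) * n.choose i *
        (Real.Gamma (β + i + 1 + n) / Real.Gamma (β + i + 1) *
          (Real.Gamma (α + β + n + i + 1) / Real.Gamma (α + β + i + n + 2))) =
      (-1) ^ n * (ascPochhammer ℝ n).eval (α + 1) *
        ((-1) ^ n * n.factorial / (ascPochhammer ℝ (n + 1)).eval (α + β + n + 1)) := by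
    rw [← hsum]
    refine Finset.sum_congr rfl fun i _ => ?_
    congr 1
    have hi : (0 : ℝ) ≤ i := i.cast_nonneg
    have hp1 : 0 < β + i + 1 := by linarith
    have hp2 : 0 < α + β + n + i + 1 := by linarith
    have hp3 : 0 < i + (α + β + n + 1) := by linarith
    rw [show α + β + i + n + 2 = α + β + n + i + 1 + 1 by ring, Real.Gamma_add_one hp2.ne',
      Gamma_add_natCast hp1, mul_div_cancel_right₀ _ (Real.Gamma_pos_of_pos hp1).ne', eval_comp,
      eval_add, eval_X, eval_C, show (i : ℝ) + (β + 1) = β + i + 1 by ring,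
      show i + (α + β + n + 1) = α + β + n + i + 1 by ring]
    have := (Real.Gamma_pos_of_pos hp2).ne'
    field_simp
  have hα1 : 0 < α + 1 := by linarith
  have hsq : (-1 : ℝ) ^ n * (-1) ^ n = 1 := by rw [← mul_pow]; simp
  have e1 : Real.Gamma (α + n + 1) = (ascPochhammer ℝ n).eval (α + 1) * Real.Gamma (α + 1) := by
    rw [← Gamma_add_natCast hα1]
    congr 1
    ring
  have e2 : Real.Gamma (α + β + 2 * n + 2) =
      (ascPochhammer ℝ (n + 1)).eval (α + β + n + 1) * Real.Gamma (α + β + n + 1) := by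
    rw [← Gamma_add_natCast hc]
    congr 1
    push_cast
    ring
  have h1 := (Real.Gamma_pos_of_pos hc).ne'
  have h2 := (ascPochhammer_pos (n + 1) _ hc).ne'
  have h3 := (Real.Gamma_pos_of_pos (show 0 < α + β + 2 * n + 1 by linarith)).ne'
  rw [hsum', e1, e2, show α + β + n + n + 1 = α + β + 2 * n + 1 by ring]
  field_simp
  linear_combination
    (Real.Gamma (β + n + 1) * (ascPochhammer ℝ n).eval (α + 1)) * hsq

end

/-! ### Derivatives of the kernel at (-1, -1) and their limit. -/

theorem iteratedDeriv_eval (p : ℝ[X]) (k : ℕ) :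
    iteratedDeriv k (fun x => p.eval x) = fun x => (derivative^[k] p).eval x := by
  induction k with
  | zero => simp
  | succ k ih =>
    rw [iteratedDeriv_succ, ih, Function.iterate_succ_apply']
    funext x
    exact Polynomial.deriv _

theorem eval_iterate_derivative_eq_factorial_mul_taylor_coeff (p : ℝ[X]) (k : ℕ) (r : ℝ) :
    (derivative^[k] p).eval r = k.factorial * (taylor r p).coeff k := by
  rw [← factorial_smul_hasseDeriv, taylor_coeff]
  simp

theorem jacobiCDKernelDeriv_eq_sum (α β : ℝ) (n k s : ℕ) (x y : ℝ) :
    jacobiCDKernelDeriv α β n k s x y =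
      ∑ j ∈ Finset.range (n + 1),
        (derivative^[k] (jacobiP α β j)).eval x * (derivative^[s] (jacobiP α β j)).eval y /
          polyInner (jacobiMeasure α β) (jacobiP α β j) (jacobiP α β j) := by
  have h1 : ∀ u : ℝ, iteratedDeriv s (fun v => jacobiCDKernel α β n u v) y =
      (∑ j ∈ Finset.range (n + 1), C ((derivative^[s] (jacobiP α β j)).eval y /
        polyInner (jacobiMeasure α β) (jacobiP α β j) (jacobiP α β j)) * jacobiP α β j).eval u := by
    intro u
    have h2 : (fun v => jacobiCDKernel α β n u v) = fun v =>
        (∑ j ∈ Finset.range (n + 1), C ((jacobiP α β j).eval u /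
          polyInner (jacobiMeasure α β) (jacobiP α β j) (jacobiP α β j)) *
            jacobiP α β j).eval v := by
      funext v
      rw [jacobiCDKernel, eval_finsetSum]
      refine Finset.sum_congr rfl fun j _ => ?_
      rw [eval_mul, eval_C]
      ring
    rw [h2, iteratedDeriv_eval, iterate_derivative_sum]
    simp only [eval_finsetSum, iterate_derivative_C_mul, eval_mul, eval_C]
    exact Finset.sum_congr rfl fun j _ => by ring
  rw [jacobiCDKernelDeriv, funext h1, iteratedDeriv_eval, iterate_derivative_sum]
  simp only [eval_finsetSum, iterate_derivative_C_mul, eval_mul, eval_C]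
  exact Finset.sum_congr rfl fun j _ => by ring

theorem eval_neg_one_iterate_derivative_jacobiP {α β : ℝ} (hα : -1 < α) (hβ : -1 < β) {n : ℕ}
    (hn : 1 ≤ n) (k : ℕ) :
    (derivative^[k] (jacobiP α β n)).eval (-1) = k.factorial * jacobiCoeff α β n k := by
  rw [eval_iterate_derivative_eq_factorial_mul_taylor_coeff, jacobiP_eq_jacobiExplicit hα hβ hn,
    taylor_neg_one_jacobiExplicit_coeff]

/-- The spelling n + -k + 1 matches `tendsto_Gamma_add_div` at a = -k. -/
theorem factorial_mul_choose_eq_div_Gamma {n k : ℕ} (h : k ≤ n) :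
    (k.factorial : ℝ) * n.choose k = n.factorial / Real.Gamma (n + -(k : ℝ) + 1) := by
  have e : (n : ℝ) + -(k : ℝ) + 1 = ((n - k : ℕ) : ℝ) + 1 := by
    rw [Nat.cast_sub h]
    ring
  rw [e, Real.Gamma_nat_eq_factorial, Nat.cast_choose ℝ h]
  field_simp

/-- The powers of 2 that depend on n and Γ(α + β + 2n + 1) cancel, leaving only factors covered by
`tendsto_Gamma_add_div` and one linear factor in n. -/
theorem jacobiCDKernelDeriv_summand {α β : ℝ} (hα : -1 < α) (hβ : -1 < β) {n k s : ℕ}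
    (hn : 1 ≤ n) (hk : k ≤ n) (hs : s ≤ n) :
    (derivative^[k] (jacobiP α β n)).eval (-1) * (derivative^[s] (jacobiP α β n)).eval (-1) /
        polyInner (jacobiMeasure α β) (jacobiP α β n) (jacobiP α β n) =
      (-1) ^ (k + s) / (2 ^ (α + β + k + s + 1) * Real.Gamma (β + k + 1) *
        Real.Gamma (β + s + 1)) *
      ((n.factorial / Real.Gamma (n + -(k : ℝ) + 1)) *
        (n.factorial / Real.Gamma (n + -(s : ℝ) + 1)) * (Real.Gamma (n + β + 1) / n.factorial) *
        (Real.Gamma (n + (α + β + k) + 1) / Real.Gamma (n + (α + β) + 1)) *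
        (Real.Gamma (n + (α + β + s) + 1) / Real.Gamma (n + α + 1)) * (α + β + 2 * n + 1)) := by
  have hn' : (1 : ℝ) ≤ n := by exact_mod_cast hn
  have hk0 : (0 : ℝ) ≤ k := k.cast_nonneg
  have hs0 : (0 : ℝ) ≤ s := s.cast_nonneg
  have hc : 0 < α + β + 2 * n + 1 := by linarith
  rw [eval_neg_one_iterate_derivative_jacobiP hα hβ hn,
    eval_neg_one_iterate_derivative_jacobiP hα hβ hn, polyInner_jacobiP_self hα hβ hn,
    ← factorial_mul_choose_eq_div_Gamma hk, ← factorial_mul_choose_eq_div_Gamma hs,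
    jacobiCoeff, jacobiCoeff, show α + β + 2 * n + 2 = α + β + 2 * n + 1 + 1 by ring,
    Real.Gamma_add_one hc.ne',
    show (n : ℝ) + β + 1 = β + n + 1 by ring, show (n : ℝ) + α + 1 = α + n + 1 by ring,
    show (n : ℝ) + (α + β) + 1 = α + β + n + 1 by ring,
    show (n : ℝ) + (α + β + k) + 1 = α + β + n + k + 1 by ring,
    show (n : ℝ) + (α + β + s) + 1 = α + β + n + s + 1 by ring]
  have hsign : (-1 : ℝ) ^ (k + s) = (-1) ^ (n - k) * (-1) ^ (n - s) := by
    rw [← pow_add, neg_one_pow_congr]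
    simp only [Nat.even_add, Nat.even_sub hk, Nat.even_sub hs]
    tauto
  have hpow : (2 : ℝ) ^ (α + β + 2 * n + 1) =
      2 ^ ((n : ℝ) - k) * 2 ^ ((n : ℝ) - s) * 2 ^ (α + β + k + s + 1) := by
    rw [← Real.rpow_add two_pos, ← Real.rpow_add two_pos]
    congr 1
    ring
  rw [hsign, hpow]
  have p1 := (Real.rpow_pos_of_pos two_pos ((n : ℝ) - k)).ne'
  have p2 := (Real.rpow_pos_of_pos two_pos ((n : ℝ) - s)).ne'
  have p3 := (Real.rpow_pos_of_pos two_pos (α + β + k + s + 1)).ne'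
  have g1 := (Real.Gamma_pos_of_pos (show 0 < β + n + 1 by linarith)).ne'
  have g2 := (Real.Gamma_pos_of_pos (show 0 < α + n + 1 by linarith)).ne'
  have g3 := (Real.Gamma_pos_of_pos (show 0 < α + β + n + 1 by linarith)).ne'
  have g4 := (Real.Gamma_pos_of_pos hc).ne'
  have g5 := (Real.Gamma_pos_of_pos (show 0 < β + k + 1 by linarith)).ne'
  have g6 := (Real.Gamma_pos_of_pos (show 0 < β + s + 1 by linarith)).ne'
  have f : (n.factorial : ℝ) ≠ 0 := by exact_mod_cast n.factorial_ne_zero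
  generalize (2 : ℝ) ^ ((n : ℝ) - k) = a1 at *
  generalize (2 : ℝ) ^ ((n : ℝ) - s) = a2 at *
  generalize (2 : ℝ) ^ (α + β + k + s + 1) = a3 at *
  generalize Real.Gamma (β + n + 1) = b1 at *
  generalize Real.Gamma (α + n + 1) = b2 at *
  generalize Real.Gamma (α + β + n + 1) = b3 at *
  generalize Real.Gamma (α + β + 2 * n + 1) = b4 at *
  generalize Real.Gamma (β + k + 1) = b5 at *
  generalize Real.Gamma (β + s + 1) = b6 at *
  have hc' := hc.ne'
  generalize α + β + 2 * (n : ℝ) + 1 = c at *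
  field_simp

theorem tendsto_jacobiCDKernelDeriv_summand {α β : ℝ} (hα : -1 < α) (hβ : -1 < β) (k s : ℕ) :
    Tendsto (fun n : ℕ =>
      (derivative^[k] (jacobiP α β n)).eval (-1) * (derivative^[s] (jacobiP α β n)).eval (-1) /
        polyInner (jacobiMeasure α β) (jacobiP α β n) (jacobiP α β n) /
          (n : ℝ) ^ (2 * β + 2 * k + 2 * s + 2 - 1)) atTop
      (𝓝 ((-1) ^ (k + s) / (2 ^ (α + β + k + s + 1) * Real.Gamma (β + k + 1) *
        Real.Gamma (β + s + 1)) * 2)) := by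
  have hlin : Tendsto (fun n : ℕ => 2 * (((n : ℝ) + (α + β + 1) / 2) / n)) atTop (𝓝 2) := by
    simpa using (tendsto_natCast_add_div ((α + β + 1) / 2)).const_mul 2
  have h := (((((((tendsto_Gamma_add_div (-(k : ℝ))).inv₀ one_ne_zero).mul
    ((tendsto_Gamma_add_div (-(s : ℝ))).inv₀ one_ne_zero)).mul
    (tendsto_Gamma_add_div β)).mul
    ((tendsto_Gamma_add_div (α + β + k)).div (tendsto_Gamma_add_div (α + β)) one_ne_zero)).mul
    ((tendsto_Gamma_add_div (α + β + s)).div (tendsto_Gamma_add_div α) one_ne_zero)).mul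
    hlin).const_mul ((-1 : ℝ) ^ (k + s) / (2 ^ (α + β + k + s + 1) * Real.Gamma (β + k + 1) *
        Real.Gamma (β + s + 1)))
  simp only [inv_one, div_one, one_mul] at h
  refine h.congr' ?_
  filter_upwards [eventually_ge_atTop 1, eventually_ge_atTop k, eventually_ge_atTop s]
    with n hn hk hs
  have hn' : (0 : ℝ) < n := by exact_mod_cast hn
  rw [jacobiCDKernelDeriv_summand hα hβ hn hk hs]
  simp only [Pi.div_apply]
  rw [mul_div_assoc]
  congr 1
  -- The growth orders are k and s from the factorial quotients, β from Γ(n + β + 1)/n!, k and β + s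
  -- from the remaining Gamma quotients, and 1 from the linear factor.
  have hpow : (n : ℝ) ^ (2 * β + 2 * k + 2 * s + 2 - 1) =
      (n : ℝ) ^ k * n ^ s * n ^ β * n ^ β * n ^ k * n ^ s * n := by
    rw [← Real.rpow_natCast, ← Real.rpow_natCast, ← Real.rpow_add hn', ← Real.rpow_add hn',
      ← Real.rpow_add hn', ← Real.rpow_add hn', ← Real.rpow_add hn', ← Real.rpow_add_one hn'.ne']
    congr 1
    ring
  rw [hpow]
  simp only [Real.rpow_add hn', Real.rpow_neg hn'.le, Real.rpow_natCast]
  have f : (n.factorial : ℝ) ≠ 0 := by exact_mod_cast n.factorial_ne_zero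
  have p1 := (Real.rpow_pos_of_pos hn' α).ne'
  have p2 := (Real.rpow_pos_of_pos hn' β).ne'
  field_simp
  ring

theorem lemma4p3 (α β : ℝ) (hα : -1 < α) (hβ : -1 < β) (k s : ℕ) :
    Tendsto
      (fun n : ℕ => jacobiCDKernelDeriv α β (n - 1) k s (-1) (-1) /
        (n : ℝ) ^ (2 * β + 2 * (k : ℝ) + 2 * (s : ℝ) + 2))
      atTop
      (𝓝 ((-1 : ℝ) ^ (k + s) /
        ((2 : ℝ) ^ (α + β + (k : ℝ) + (s : ℝ) + 1) * (β + (k : ℝ) + (s : ℝ) + 1) *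
          Real.Gamma (β + (k : ℝ) + 1) * Real.Gamma (β + (s : ℝ) + 1)))) := by
  have hk0 : (0 : ℝ) ≤ k := k.cast_nonneg
  have hs0 : (0 : ℝ) ≤ s := s.cast_nonneg
  have hp : 0 < 2 * β + 2 * (k : ℝ) + 2 * (s : ℝ) + 2 := by linarith
  have h := tendsto_sum_range_div_rpow hp (tendsto_jacobiCDKernelDeriv_summand hα hβ k s)
  have hlim : (-1 : ℝ) ^ (k + s) / (2 ^ (α + β + k + s + 1) * Real.Gamma (β + k + 1) *
      Real.Gamma (β + s + 1)) * 2 / (2 * β + 2 * (k : ℝ) + 2 * (s : ℝ) + 2) =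
      (-1 : ℝ) ^ (k + s) / ((2 : ℝ) ^ (α + β + (k : ℝ) + (s : ℝ) + 1) *
        (β + (k : ℝ) + (s : ℝ) + 1) * Real.Gamma (β + (k : ℝ) + 1) *
          Real.Gamma (β + (s : ℝ) + 1)) := by
    rw [show 2 * β + 2 * (k : ℝ) + 2 * (s : ℝ) + 2 = 2 * (β + k + s + 1) by ring,
      mul_comm _ (2 : ℝ), mul_div_mul_left _ _ two_ne_zero, div_div]
    congr 1
    ring
  rw [hlim] at h
  refine h.congr' ?_
  -- The kernel of index n - 1 sums over j < (n - 1) + 1, which is j < n only for n ≥ 1 under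
  -- truncated subtraction.
  filter_upwards [eventually_ge_atTop 1] with n hn
  rw [jacobiCDKernelDeriv_eq_sum, Nat.sub_add_cancel hn]
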